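/- Let $0\le\underline\sigma\le\overline\sigma<\infty$ with $\overline\sigma>0$, let $c\in\mathbb R$, and let $\phi$ and $\Phi$ be the density and the distribution function of the standard normal distribution. Let $w:[0,\infty)\times\mathbb R\to\mathbb R$ be the viscosity solution of the G-heat equation $$w_t=\tfrac12\left(\overline\sigma^2(w_{xx})^+-\underline\sigma^2(w_{xx})^-\right)\quad\text{on }(0,\infty)\times\mathbb R,\qquad w(0,x)=\mathbf 1\{|x|>c\}.$$ Here a viscosity solution is continuous on $(0,\infty)\times\mathbb R$, has at most polynomial growth in $x$ uniformly on bounded time intervals, and attains its initial value $\varphi=\mathbf 1\{|\cdot|>c\}$ at $t=0$ and in the sense that $\varphi_*(x_0)\le\liminf w(t,x)\le\limsup w(t,x)\le\varphi^*(x_0)$ as $(t,x)\to(0^+,x_0)$ for every $x_0\in\mathbb R$, where $\varphi_*$ and $\varphi^*$ are the lower and upper semicontinuous envelopes of $\varphi$. Put $$f(y)=\frac{2}{\overline\sigma+\underline\sigma}\int_{-y}^\infty\left\{\phi(z/\overline\sigma)\mathbf 1\{z\ge0\}+\phi(z/\underline\sigma)\mathbf 1\{z<0\}\right\}dz,$$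 where, if $\underline\sigma=0$, $\phi(z/\underline\sigma)$ is read as $0$ for $z<0$. For $t>0$ let $u(t,x)=f\left((x-c)/\sqrt t\right)$ and $v(t,x)=f\left((-x-c)/\sqrt t\right)$, and let $u(0,x)=\mathbf 1\{x>c\}$ and $v(0,x)=\mathbf 1\{x<-c\}$. Then for all $x\in\mathbb R$ and all $t\ge0$ with $c>\overline\sigma\sqrt t/2$, $$0\le u(t,x)+v(t,x)-w(t,x)\le\frac{2(\overline\sigma-\underline\sigma)}{\overline\sigma}\,\Phi\left(-\frac{2c}{\overline\sigma\sqrt t}\right),$$ where $\Phi\left(-2c/(\overline\sigma\sqrt t)\right)$ is read as $\Phi(-\infty)=0$ at $t=0$. -/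

import Mathlib

open Set Filter Topology MeasureTheory ProbabilityTheory

/-- The nonlinearity of the G-heat equation, `G(a) = ½ (σu² a⁺ - σl² a⁻)`, where
`a⁺ = max a 0` and `a⁻ = max (-a) 0`. Here `σl` is the lower and `σu` the upper volatility. -/
noncomputable def gFun (σl σu a : ℝ) : ℝ := (1 / 2) * (σu ^ 2 * a⁺ - σl ^ 2 * a⁻)

/-- `w` (a function of time and space) is a viscosity subsolution of `w_t = G(w_xx)` on
`(0, ∞) × ℝ`: at every local maximum of `w - ψ`, with `ψ` of class `C²` near that point,
`ψ_t ≤ G(ψ_xx)`. -/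
def IsGHeatSubsolution (σl σu : ℝ) (w : ℝ → ℝ → ℝ) : Prop :=
  ∀ (ψ : ℝ × ℝ → ℝ) (t x : ℝ), 0 < t → ContDiffAt ℝ 2 ψ (t, x) →
    IsLocalMax (fun p : ℝ × ℝ => w p.1 p.2 - ψ p) (t, x) →
    deriv (fun s => ψ (s, x)) t ≤ gFun σl σu (iteratedDeriv 2 (fun y => ψ (t, y)) x)

/-- `w` is a viscosity supersolution of `w_t = G(w_xx)` on `(0, ∞) × ℝ`: at every local minimum
of `w - ψ`, with `ψ` of class `C²` near that point, `ψ_t ≥ G(ψ_xx)`. -/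
def IsGHeatSupersolution (σl σu : ℝ) (w : ℝ → ℝ → ℝ) : Prop :=
  ∀ (ψ : ℝ × ℝ → ℝ) (t x : ℝ), 0 < t → ContDiffAt ℝ 2 ψ (t, x) →
    IsLocalMin (fun p : ℝ × ℝ => w p.1 p.2 - ψ p) (t, x) →
    gFun σl σu (iteratedDeriv 2 (fun y => ψ (t, y)) x) ≤ deriv (fun s => ψ (s, x)) t

/-- `w` is a viscosity solution of the Cauchy problem `w_t = G(w_xx)` on `(0, ∞) × ℝ`,
`w(0, ·) = φ`, where `φ` may be discontinuous: the initial value is attained pointwise at `t = 0`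
and, as `t ↓ 0`, between the semicontinuous envelopes of `φ`. Only the values `w t x` with `t ≥ 0`
matter. -/
structure IsGHeatSolution (σl σu : ℝ) (φ : ℝ → ℝ) (w : ℝ → ℝ → ℝ) : Prop where
  /-- `w` is continuous at positive times. -/
  continuousOn : ContinuousOn (fun p : ℝ × ℝ => w p.1 p.2) {p | 0 < p.1}
  /-- `w` is a viscosity subsolution. -/
  sub : IsGHeatSubsolution σl σu w
  /-- `w` is a viscosity supersolution. -/
  super : IsGHeatSupersolution σl σu w
  /-- The initial condition. -/
  initial : ∀ x, w 0 x = φ x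
  /-- `limsup w(t, x) ≤ φ^*(x₀)` as `(t, x) → (0+, x₀)`, where the upper semicontinuous envelope
  `φ^*(x₀)` is the infimum of the upper bounds `a` of `φ` near `x₀`. -/
  limsup_le : ∀ x₀ a : ℝ, (∀ᶠ y in 𝓝 x₀, φ y ≤ a) → ∀ ε : ℝ, 0 < ε →
    ∀ᶠ p in 𝓝[{p : ℝ × ℝ | 0 < p.1}] ((0 : ℝ), x₀), w p.1 p.2 ≤ a + ε
  /-- `liminf w(t, x) ≥ φ_*(x₀)` as `(t, x) → (0+, x₀)`, where the lower semicontinuous envelope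
  `φ_*(x₀)` is the supremum of the lower bounds `a` of `φ` near `x₀`. -/
  le_liminf : ∀ x₀ a : ℝ, (∀ᶠ y in 𝓝 x₀, a ≤ φ y) → ∀ ε : ℝ, 0 < ε →
    ∀ᶠ p in 𝓝[{p : ℝ × ℝ | 0 < p.1}] ((0 : ℝ), x₀), a - ε ≤ w p.1 p.2
  /-- Polynomial growth in `x`, uniformly on bounded time intervals. -/
  growth : ∀ T : ℝ, 0 < T → ∃ (C : ℝ) (k : ℕ), ∀ t ∈ Icc (0 : ℝ) T, ∀ x : ℝ,
    |w t x| ≤ C * (1 + |x| ^ k)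

/-- The density of the standard normal distribution. -/
noncomputable def stdPDF (z : ℝ) : ℝ := gaussianPDFReal 0 1 z

/-- The distribution function `Φ` of the standard normal distribution. -/
noncomputable def stdCDF (z : ℝ) : ℝ := cdf (gaussianReal 0 1) z

/-- The profile
`f(y) = 2 / (σu + σl) * ∫_{-y}^∞ (φ(z/σu) 1{z ≥ 0} + φ(z/σl) 1{z < 0}) dz`, where `φ` is the standard
normal density. If `σl = 0`, then `φ(z/σl)` for `z < 0` means its limit `φ(-∞) = 0`. -/
noncomputable def profile (σl σu y : ℝ) : ℝ :=
  2 / (σu + σl) * ∫ z in Ioi (-y),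
    if 0 ≤ z then stdPDF (z / σu) else if σl = 0 then 0 else stdPDF (z / σl)

/-- The one-sided solution `u(t, x) = f((x - c) / √t)` for `t > 0`, `u(0, x) = 1{x > c}`. -/
noncomputable def rightSol (σl σu c t x : ℝ) : ℝ :=
  if 0 < t then profile σl σu ((x - c) / √t) else (Ioi c).indicator 1 x

/-- The one-sided solution `v(t, x) = f((-x - c) / √t)` for `t > 0`, `v(0, x) = 1{x < -c}`. -/
noncomputable def leftSol (σl σu c t x : ℝ) : ℝ :=
  if 0 < t then profile σl σu ((-x - c) / √t) else (Iio (-c)).indicator 1 x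

/-- `Φ(-2c / (σu √t))` for `t > 0`, and its limit `Φ(-∞) = 0` (for `c > 0`) at `t = 0`. -/
noncomputable def gaussTail (σu c t : ℝ) : ℝ :=
  if 0 < t then stdCDF (-(2 * c) / (σu * √t)) else 0

/-! The profile `f` is convex with volatility `σu` on the negative axis and concave with volatility
`σl` on the positive one, and satisfies `G(f'') = -y f'/2`; thus `u` and `v` solve the G-heat
equation. Since `G` is subadditive, `u + v` is a supersolution and dominates `w`
(`IsGHeatSolution.le_twoSided`).

For the lower bound, subtract from `u + v` a gap. On `|x| ≤ c` both summands are convex, so `u + v`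
solves the heat equation with volatility `σu`; the gap there is a multiple of `Φ(-2c/(σu√t))`,
constant in `x` and increasing in `t`, which leaves a subsolution. On `|x| > c` the far summand is
replaced by a solution of the heat equation with volatility `σl`, fitted to value and slope at `|x|
= c`; since `G(a) ≥ σl² a / 2`, this is again a subsolution. By concavity of `Φ` on `[0, ∞)` the gap
is largest on `|x| ≤ c` (`barrierGap_le`), so the barrier lies below `w` and within the claimed
error of `u + v` (`IsGHeatSolution.twoSided_sub_le`).

Both bounds use `viscosity_comparison`. As the initial datum jumps, the barriers are built with `c'
≠ c`, ordered correctly as `t ↓ 0`, and then `c' → c`. The case `σl = 0` of the lower bound is a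
limit of positive lower volatilities. -/

/-! ### Calculus of test functions. -/

/-- `ψ` is of class `C²` at `(t, x)`, with time derivative `a` and second space derivative `b`. -/
structure HasHeatJet (ψ : ℝ × ℝ → ℝ) (t x a b : ℝ) : Prop where
  contDiffAt : ContDiffAt ℝ 2 ψ (t, x)
  time : deriv (fun s => ψ (s, x)) t = a
  space : iteratedDeriv 2 (fun y => ψ (t, y)) x = b

namespace HasHeatJet

variable {ψ ψ₁ ψ₂ : ℝ × ℝ → ℝ} {t x a b a₁ b₁ a₂ b₂ : ℝ}

theorem contDiffAt_time (h : HasHeatJet ψ t x a b) : ContDiffAt ℝ 2 (fun s => ψ (s, x)) t :=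
  ContDiffAt.comp (f := fun s : ℝ => (s, x)) t h.contDiffAt (by fun_prop)

theorem contDiffAt_space (h : HasHeatJet ψ t x a b) : ContDiffAt ℝ 2 (fun y => ψ (t, y)) x :=
  ContDiffAt.comp (f := fun y : ℝ => (t, y)) x h.contDiffAt (by fun_prop)

theorem add (h₁ : HasHeatJet ψ₁ t x a₁ b₁) (h₂ : HasHeatJet ψ₂ t x a₂ b₂) :
    HasHeatJet (fun p => ψ₁ p + ψ₂ p) t x (a₁ + a₂) (b₁ + b₂) where
  contDiffAt := h₁.contDiffAt.add h₂.contDiffAt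
  time := by
    rw [← h₁.time, ← h₂.time]
    exact deriv_fun_add (h₁.contDiffAt_time.differentiableAt (by norm_num))
      (h₂.contDiffAt_time.differentiableAt (by norm_num))
  space := by
    rw [← h₁.space, ← h₂.space]
    exact iteratedDeriv_fun_add h₁.contDiffAt_space h₂.contDiffAt_space

theorem const_mul (r : ℝ) (h : HasHeatJet ψ t x a b) :
    HasHeatJet (fun p => r * ψ p) t x (r * a) (r * b) where
  contDiffAt := contDiffAt_const.mul h.contDiffAt
  time := by
    rw [← h.time]
    exact deriv_const_mul r (h.contDiffAt_time.differentiableAt (by norm_num))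
  space := by
    rw [← h.space]
    exact iteratedDeriv_const_mul r h.contDiffAt_space

theorem neg (h : HasHeatJet ψ t x a b) : HasHeatJet (fun p => -ψ p) t x (-a) (-b) := by
  simpa using h.const_mul (-1)

theorem sub (h₁ : HasHeatJet ψ₁ t x a₁ b₁) (h₂ : HasHeatJet ψ₂ t x a₂ b₂) :
    HasHeatJet (fun p => ψ₁ p - ψ₂ p) t x (a₁ - a₂) (b₁ - b₂) := by
  simpa only [sub_eq_add_neg] using h₁.add h₂.neg

theorem of_hasDerivAt {a' : ℝ → ℝ} (hc : ContDiffAt ℝ 2 ψ (t, x))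
    (ht : HasDerivAt (fun s => ψ (s, x)) a t) (hx : ∀ y, HasDerivAt (fun y => ψ (t, y)) (a' y) y)
    (hxx : HasDerivAt a' b x) : HasHeatJet ψ t x a b where
  contDiffAt := hc
  time := ht.deriv
  space := by
    rw [iteratedDeriv_succ, iteratedDeriv_one, funext fun y => (hx y).deriv]
    exact hxx.deriv

end HasHeatJet

theorem hasHeatJet_exp_mul_cosh (l t x : ℝ) :
    HasHeatJet (fun p => Real.exp (l * p.1) * Real.cosh p.2) t x
      (l * (Real.exp (l * t) * Real.cosh x)) (Real.exp (l * t) * Real.cosh x) := by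
  refine .of_hasDerivAt (a' := fun y => Real.exp (l * t) * Real.sinh y)
    (ContDiff.contDiffAt (by fun_prop)) ?_
    (fun y => by simpa only using (Real.hasDerivAt_cosh y).const_mul (Real.exp (l * t)))
    ((Real.hasDerivAt_sinh x).const_mul _)
  refine ((((hasDerivAt_id t).const_mul l).exp).mul_const (Real.cosh x)).congr_deriv ?_
  simp only [id, mul_one]
  ring

theorem hasHeatJet_inv_sub {T t : ℝ} (x : ℝ) (ht : t < T) :
    HasHeatJet (fun p => (T - p.1)⁻¹) t x ((T - t) ^ 2)⁻¹ 0 := by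
  have h0 : T - t ≠ 0 := (sub_pos.2 ht).ne'
  refine .of_hasDerivAt (a' := fun _ => 0)
    (ContDiffAt.inv (by fun_prop) h0) ?_ (fun y => by simpa only using hasDerivAt_const y (T - t)⁻¹)
    (hasDerivAt_const _ _)
  refine (((hasDerivAt_id t).const_sub T).inv h0).congr_deriv ?_
  simp

/-- A self-similar function `h((e x - d) / √t)` and its derivatives. -/
theorem hasHeatJet_selfSimilar {h h' h'' : ℝ → ℝ} (hh : ∀ y, HasDerivAt h (h' y) y)
    (hh' : ∀ y, HasDerivAt h' (h'' y) y) (hc : Continuous h'') (e d : ℝ) {t : ℝ} (x : ℝ)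
    (ht : 0 < t) :
    HasHeatJet (fun p => h ((e * p.2 - d) / √p.1)) t x
      (-((e * x - d) / √t) * h' ((e * x - d) / √t) / (2 * t))
      (e ^ 2 * h'' ((e * x - d) / √t) / t) := by
  have hs : √t ≠ 0 := (Real.sqrt_pos.2 ht).ne'
  have hC : ContDiff ℝ 2 h := by
    have h1 : deriv h = h' := funext fun y => (hh y).deriv
    have h2 : deriv h' = h'' := funext fun y => (hh' y).deriv
    have e2 : (2 : WithTop ℕ∞) = 1 + 1 := by norm_num
    rw [e2, contDiff_succ_iff_deriv]
    refine ⟨fun y => (hh y).differentiableAt, by simp, ?_⟩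
    rw [h1, contDiff_one_iff_deriv, h2]
    exact ⟨fun y => (hh' y).differentiableAt, hc⟩
  refine .of_hasDerivAt (a' := fun y => h' ((e * y - d) / √t) * (e / √t)) ?_ ?_ ?_ ?_
  · refine hC.contDiffAt.comp (t, x) (ContDiffAt.div (by fun_prop) ?_ hs)
    exact (Real.contDiffAt_sqrt ht.ne').comp (t, x) contDiffAt_fst
  · have h1 : HasDerivAt (fun s => (e * x - d) / √s)
        (-((e * x - d) / √t) / (2 * t)) t := by
      refine (((Real.hasDerivAt_sqrt ht.ne').inv hs).const_mul (e * x - d)).congr_deriv ?_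
      rw [Real.sq_sqrt ht.le]
      field_simp
    refine ((hh _).comp t h1).congr_deriv ?_
    ring
  · intro y
    have h1 : HasDerivAt (fun y => (e * y - d) / √t) (e / √t) y := by
      simpa using (((hasDerivAt_id y).const_mul e).sub_const d).div_const √t
    exact (hh _).comp y h1
  · have h1 : HasDerivAt (fun y => (e * y - d) / √t) (e / √t) x := by
      simpa using (((hasDerivAt_id x).const_mul e).sub_const d).div_const √t
    refine (((hh' _).comp x h1).mul_const (e / √t)).congr_deriv ?_
    rw [mul_assoc, div_mul_div_comm, Real.mul_self_sqrt ht.le]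
    ring

/-! ### Comparison principle. -/

/-- A continuous function on the strip `0 < t < T` has a local maximum if it takes some value that
it does not reach near the boundary and at infinity. -/
theorem exists_isLocalMax_strip {F : ℝ × ℝ → ℝ} {T R : ℝ} {p₀ : ℝ × ℝ}
    (hF : ContinuousOn F {p | 0 < p.1 ∧ p.1 < T}) (hp₀ : 0 < p₀.1 ∧ p₀.1 < T)
    (hR : ∀ p : ℝ × ℝ, 0 < p.1 → p.1 < T → R < |p.2| → F p < F p₀)
    (h0 : ∀ x, ∀ᶠ p in 𝓝[{p : ℝ × ℝ | 0 < p.1 ∧ p.1 < T}] ((0 : ℝ), x), F p < F p₀)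
    (hT : ∀ x, ∀ᶠ p in 𝓝[{p : ℝ × ℝ | 0 < p.1 ∧ p.1 < T}] (T, x), F p < F p₀) :
    ∃ p : ℝ × ℝ, (0 < p.1 ∧ p.1 < T) ∧ IsLocalMax F p := by
  set Ω : Set (ℝ × ℝ) := {p | 0 < p.1 ∧ p.1 < T} with hΩ
  have hΩo : IsOpen Ω := (isOpen_lt continuous_const continuous_fst).inter
    (isOpen_lt continuous_fst continuous_const)
  set K : Set (ℝ × ℝ) := {p | p ∈ Ω ∧ F p₀ ≤ F p} with hK
  have hsub : K ⊆ Icc 0 T ×ˢ Icc (-R) R := by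
    rintro p ⟨hp, hpF⟩
    refine ⟨⟨hp.1.le, hp.2.le⟩, abs_le.1 ?_⟩
    by_contra! h
    exact (hR p hp.1 hp.2 h).not_ge hpF
  -- The strip is open, but its superlevel set is closed in the plane: `h0` and `hT` keep it away
  -- from the two boundary lines.
  have hclosed : IsClosed K := by
    refine isClosed_of_closure_subset fun p hp => ?_
    have hbox := closure_minimal hsub (isClosed_Icc.prod isClosed_Icc) hp
    have hfreq : ∃ᶠ q in 𝓝 p, q ∈ K := mem_closure_iff_frequently.1 hp
    have key : ¬ ∀ᶠ q in 𝓝[Ω] p, F q < F p₀ := by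
      intro h
      rw [eventually_nhdsWithin_iff] at h
      exact hfreq (h.mono fun q hq hqK => (hq hqK.1).not_ge hqK.2)
    have hpΩ : p ∈ Ω := by
      obtain ⟨s, y⟩ := p
      refine ⟨lt_of_le_of_ne hbox.1.1 ?_, lt_of_le_of_ne hbox.1.2 ?_⟩
      · rintro rfl
        exact key (h0 y)
      · rintro rfl
        exact key (hT y)
    refine ⟨hpΩ, not_lt.1 fun hlt => key ?_⟩
    exact (hF p hpΩ).eventually_lt_const hlt
  have hcomp : IsCompact K := (isCompact_Icc.prod isCompact_Icc).of_isClosed_subset hclosed hsub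
  obtain ⟨p, hpK, hmax⟩ := hcomp.exists_isMaxOn ⟨p₀, hp₀, le_rfl⟩ (hF.mono fun q hq => hq.1)
  refine ⟨p, hpK.1, ?_⟩
  filter_upwards [hΩo.mem_nhds hpK.1] with q hq
  by_cases h : F p₀ ≤ F q
  · exact hmax ⟨hq, h⟩
  · exact (not_le.1 h).le.trans hpK.2

theorem exists_growth_lt_cosh (C : ℝ) (k : ℕ) {δ : ℝ} (hδ : 0 < δ) :
    ∃ R : ℝ, ∀ x : ℝ, R < |x| → C * (1 + |x| ^ k) < δ * Real.cosh x := by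
  have h : (fun x : ℝ => C * (1 + x ^ k)) =o[atTop] Real.exp := by
    refine Asymptotics.IsLittleO.const_mul_left (Asymptotics.IsLittleO.add ?_ ?_) _
    · simpa using Real.isLittleO_pow_exp_atTop (n := 0)
    · exact Real.isLittleO_pow_exp_atTop
  obtain ⟨R, hR⟩ := eventually_atTop.1 (h.bound (show 0 < δ / 4 by positivity))
  refine ⟨R, fun x hx => ?_⟩
  have h1 := (le_abs_self _).trans (hR |x| hx.le)
  rw [Real.norm_of_nonneg (Real.exp_pos _).le] at h1
  have h2 : Real.exp |x| / 2 ≤ Real.cosh x := by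
    rw [← Real.cosh_abs, Real.cosh_eq]
    linarith [Real.exp_pos (-|x|)]
  have := Real.exp_pos |x|
  nlinarith

/-- Comparison of a viscosity subsolution `w` of `w_t = G(w_xx)` with a function `U` that is touched
from above, at every point, by a classical supersolution. -/
theorem viscosity_comparison {G : ℝ → ℝ} {L : ℝ} (hL : 0 < L)
    (hG : ∀ a b, 0 ≤ b → G (a + b) ≤ G a + L * b) {w U : ℝ → ℝ → ℝ}
    (hw : ContinuousOn (fun p : ℝ × ℝ => w p.1 p.2) {p | 0 < p.1})
    (hU : ContinuousOn (fun p : ℝ × ℝ => U p.1 p.2) {p | 0 < p.1})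
    (hsub : ∀ (ψ : ℝ × ℝ → ℝ) (t x a b : ℝ), 0 < t → HasHeatJet ψ t x a b →
      IsLocalMax (fun p : ℝ × ℝ => w p.1 p.2 - ψ p) (t, x) → a ≤ G b)
    (htouch : ∀ t x : ℝ, 0 < t → ∃ (ψ : ℝ × ℝ → ℝ) (a b : ℝ), HasHeatJet ψ t x a b ∧
      (∀ᶠ p in 𝓝 (t, x), U p.1 p.2 ≤ ψ p) ∧ ψ (t, x) = U t x ∧ G b ≤ a)
    (hinit : ∀ x ε : ℝ, 0 < ε →
      ∀ᶠ p in 𝓝[{p : ℝ × ℝ | 0 < p.1}] ((0 : ℝ), x), w p.1 p.2 ≤ U p.1 p.2 + ε)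
    (hgrowth : ∀ T : ℝ, 0 < T → ∃ (C : ℝ) (k : ℕ), ∀ t ∈ Ioo (0 : ℝ) T, ∀ x : ℝ,
      w t x - U t x ≤ C * (1 + |x| ^ k))
    {t : ℝ} (ht : 0 < t) (x : ℝ) : w t x ≤ U t x := by
  set T := t + 1 with hTdef
  have hT0 : 0 < T := by positivity
  suffices H : ∀ δ : ℝ, 0 < δ →
      w t x - U t x - δ * (Real.exp (2 * L * t) * Real.cosh x + (T - t)⁻¹) ≤ 0 by
    have hlim : Tendsto (fun δ : ℝ =>
        w t x - U t x - δ * (Real.exp (2 * L * t) * Real.cosh x + (T - t)⁻¹)) (𝓝[>] 0)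
        (𝓝 (w t x - U t x - 0 * (Real.exp (2 * L * t) * Real.cosh x + (T - t)⁻¹))) :=
      (Continuous.tendsto (by fun_prop) 0).mono_left nhdsWithin_le_nhds
    have := le_of_tendsto hlim (eventually_mem_nhdsWithin.mono fun δ hδ => H δ hδ)
    linarith
  intro δ hδ
  -- The penalty does three jobs: `cosh` beats polynomial growth, `(T - t)⁻¹` blows up at the
  -- artificial final time, and the rate `2 * L` exceeds the `L` that `G` can gain from the second
  -- derivative of `cosh`, so the supersolution becomes strict.
  set F : ℝ × ℝ → ℝ := fun p =>
    w p.1 p.2 - U p.1 p.2 - δ * (Real.exp (2 * L * p.1) * Real.cosh p.2 + (T - p.1)⁻¹) with hFdef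
  by_contra! hpos
  have hpos' : 0 < F (t, x) := hpos
  have hpen : ∀ p : ℝ × ℝ, p.1 < T → 0 < Real.exp (2 * L * p.1) * Real.cosh p.2 ∧
      0 < (T - p.1)⁻¹ := fun p hp =>
    ⟨mul_pos (Real.exp_pos _) (Real.cosh_pos _), inv_pos.2 (sub_pos.2 hp)⟩
  have hFc : ContinuousOn F {p | 0 < p.1 ∧ p.1 < T} := by
    refine ((hw.mono fun p hp => hp.1).sub (hU.mono fun p hp => hp.1)).sub ?_
    refine continuousOn_const.mul (ContinuousOn.add (by fun_prop) ?_)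
    exact ContinuousOn.inv₀ (by fun_prop) fun p hp => (sub_pos.2 hp.2).ne'
  obtain ⟨C, k, hCk⟩ := hgrowth T hT0
  obtain ⟨R, hR⟩ := exists_growth_lt_cosh C k hδ
  obtain ⟨⟨s, y⟩, ⟨hs, hsT⟩, hmax⟩ := exists_isLocalMax_strip (R := R) (p₀ := (t, x)) hFc
    ⟨ht, by simp [hTdef]⟩ (by
      rintro ⟨s, y⟩ hs hsT hy
      refine lt_trans ?_ hpos'
      have h1 := hCk s ⟨hs, hsT⟩ y
      have h2 := hR y hy
      have h3 : Real.cosh y ≤ Real.exp (2 * L * s) * Real.cosh y :=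
        le_mul_of_one_le_left (Real.cosh_pos y).le (Real.one_le_exp (by positivity))
      have h4 := (hpen (s, y) hsT).2
      simp only [hFdef] at h4 ⊢
      nlinarith [mul_le_mul_of_nonneg_left h3 hδ.le, mul_pos hδ h4]) (by
      intro z
      have := (hinit z (F (t, x) / 2) (by positivity)).filter_mono
        (nhdsWithin_mono ((0 : ℝ), z) fun (p : ℝ × ℝ) (hp : 0 < p.1 ∧ p.1 < T) => hp.1)
      filter_upwards [this, self_mem_nhdsWithin] with p hp hpΩ
      obtain ⟨h1, h2⟩ := hpen p hpΩ.2
      have h3 : 0 < δ * (Real.exp (2 * L * p.1) * Real.cosh p.2 + (T - p.1)⁻¹) := by positivity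
      simp only [hFdef] at hp hpos' ⊢
      linarith) (by
      intro z
      have hopen : {p : ℝ × ℝ | 0 < p.1} ∈ 𝓝 (T, z) :=
        (isOpen_lt continuous_const continuous_fst).mem_nhds hT0
      have hcont : ContinuousAt (fun p : ℝ × ℝ => w p.1 p.2 - U p.1 p.2) (T, z) :=
        (hw.sub hU).continuousAt hopen
      set M := |w T z - U T z| + 1 with hM
      have hMpos : 0 < M := by positivity
      have e1 : ∀ᶠ p in 𝓝 (T, z), w p.1 p.2 - U p.1 p.2 < M :=
        hcont.eventually_lt_const ((le_abs_self _).trans_lt (lt_add_one _))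
      have e2 : ∀ᶠ p : ℝ × ℝ in 𝓝 (T, z), T - p.1 < δ / M := by
        have : ContinuousAt (fun p : ℝ × ℝ => T - p.1) (T, z) := by fun_prop
        refine this.eventually_lt_const ?_
        simp only [sub_self]
        positivity
      filter_upwards [e1.filter_mono nhdsWithin_le_nhds, e2.filter_mono nhdsWithin_le_nhds,
        self_mem_nhdsWithin] with p h1 h2 hpΩ
      refine lt_trans ?_ hpos'
      obtain ⟨h3, h4⟩ := hpen p hpΩ.2
      -- Near time `T` the difference `w - U` stays below `M`, so the blow-up term alone makes `F`
      -- negative.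
      have h5 : M < δ * (T - p.1)⁻¹ := by
        rw [← div_eq_mul_inv, lt_div_iff₀ (sub_pos.2 hpΩ.2), mul_comm]
        exact (lt_div_iff₀ hMpos).1 h2
      simp only [hFdef]
      nlinarith [mul_pos hδ h3])
  simp only at hs hsT
  obtain ⟨ψ, a, b, hjet, hle, heq, hGab⟩ := htouch s y hs
  have hjet' := hjet.add (((hasHeatJet_exp_mul_cosh (2 * L) s y).add
    (hasHeatJet_inv_sub y hsT)).const_mul δ)
  -- As `U ≤ ψ` with equality at the maximum point, `ψ` plus the penalty is a test function for `w`
  -- there. With `P` the `exp`-`cosh` term this gives `a + δ (2LP + (T - s)⁻²) ≤ G(b + δP) ≤ a +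
  -- LδP`, which is absurd.
  have hloc := hsub _ s y _ _ hs hjet' (by
    filter_upwards [hmax, hle] with p hp1 hp2
    simp only [hFdef] at hp1 ⊢
    rw [heq]
    linarith)
  have hP := (hpen (s, y) hsT).1
  simp only at hP
  have h1 := hG b (δ * (Real.exp (2 * L * s) * Real.cosh y + 0)) (by positivity)
  have h2 : 0 < ((T - s) ^ 2)⁻¹ := by
    have := sub_pos.2 hsT
    positivity
  have h3 := mul_pos hδ h2
  have h4 := mul_pos hδ (mul_pos hL hP)
  nlinarith

/-! ### The standard normal distribution. -/

theorem stdPDF_eq (z : ℝ) : stdPDF z = (√(2 * Real.pi))⁻¹ * Real.exp (-z ^ 2 / 2) := by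
  simp [stdPDF, gaussianPDFReal]

theorem stdPDF_pos (z : ℝ) : 0 < stdPDF z := gaussianPDFReal_pos _ _ _ one_ne_zero

theorem stdPDF_neg (z : ℝ) : stdPDF (-z) = stdPDF z := by simp [stdPDF_eq]

theorem hasDerivAt_stdPDF (z : ℝ) : HasDerivAt stdPDF (-z * stdPDF z) z := by
  have h1 : HasDerivAt (fun z : ℝ => -z ^ 2 / 2) (-z) z := by
    refine ((hasDerivAt_pow 2 z).neg.div_const 2).congr_deriv ?_
    simp
    ring
  rw [funext stdPDF_eq]
  refine (h1.exp.const_mul (√(2 * Real.pi))⁻¹).congr_deriv ?_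
  ring

theorem continuous_stdPDF : Continuous stdPDF :=
  continuous_iff_continuousAt.2 fun z => (hasDerivAt_stdPDF z).continuousAt

theorem integrable_stdPDF : Integrable stdPDF := integrable_gaussianPDFReal 0 1

theorem stdCDF_eq_integral (x : ℝ) : stdCDF x = ∫ z in Iic x, stdPDF z := by
  rw [stdCDF, cdf_eq_real, measureReal_def, gaussianReal_apply_eq_integral _ one_ne_zero,
    ENNReal.toReal_ofReal (integral_nonneg fun z => gaussianPDFReal_nonneg _ _ _)]
  rfl

theorem integral_Ioi_stdPDF (x : ℝ) : ∫ z in Ioi x, stdPDF z = stdCDF (-x) := by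
  rw [stdCDF_eq_integral, ← integral_comp_neg_Ioi]
  simp [stdPDF_neg]

theorem stdCDF_neg (x : ℝ) : stdCDF (-x) = 1 - stdCDF x := by
  have h : (∫ z in Iic x, stdPDF z) + ∫ z in Ioi x, stdPDF z = ∫ z, stdPDF z := by
    rw [← compl_Iic]
    exact integral_add_compl measurableSet_Iic integrable_stdPDF
  have h1 : ∫ z, stdPDF z = 1 := integral_gaussianPDFReal_eq_one 0 one_ne_zero
  rw [← stdCDF_eq_integral, integral_Ioi_stdPDF, h1] at h
  linarith

theorem stdCDF_zero : stdCDF 0 = 1 / 2 := by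
  have := stdCDF_neg 0
  rw [neg_zero] at this
  linarith

theorem stdCDF_nonneg (x : ℝ) : 0 ≤ stdCDF x := cdf_nonneg _ x

theorem stdCDF_le_one (x : ℝ) : stdCDF x ≤ 1 := cdf_le_one _ x

theorem monotone_stdCDF : Monotone stdCDF := monotone_cdf _

theorem hasDerivAt_stdCDF (x : ℝ) : HasDerivAt stdCDF (stdPDF x) x := by
  have h : stdCDF = fun y => stdCDF 0 + ∫ z in (0 : ℝ)..y, stdPDF z := by
    funext y
    rw [← intervalIntegral.integral_Iic_sub_Iic integrable_stdPDF.integrableOn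
      integrable_stdPDF.integrableOn, ← stdCDF_eq_integral, ← stdCDF_eq_integral]
    ring
  rw [h]
  exact (intervalIntegral.integral_hasDerivAt_right (integrable_stdPDF.intervalIntegrable)
    (continuous_stdPDF.stronglyMeasurableAtFilter _ _)
    continuous_stdPDF.continuousAt).const_add _

theorem continuous_stdCDF : Continuous stdCDF :=
  continuous_iff_continuousAt.2 fun z => (hasDerivAt_stdCDF z).continuousAt

theorem continuous_neg_mul_stdPDF : Continuous fun z => -z * stdPDF z :=
  continuous_neg.mul continuous_stdPDF

/-- The density decreases on the positive axis. This concavity is what bounds the gap in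
`barrierGap_le`. -/
theorem concaveOn_stdCDF : ConcaveOn ℝ (Ici 0) stdCDF := by
  refine AntitoneOn.concaveOn_of_deriv (convex_Ici 0) continuous_stdCDF.continuousOn
    (fun x _ => (hasDerivAt_stdCDF x).differentiableAt.differentiableWithinAt) ?_
  rw [interior_Ici]
  intro x hx y hy hxy
  rw [(hasDerivAt_stdCDF x).deriv, (hasDerivAt_stdCDF y).deriv, stdPDF_eq, stdPDF_eq]
  have : x ^ 2 ≤ y ^ 2 := pow_le_pow_left₀ (le_of_lt hx) hxy 2
  gcongr

theorem integral_Ioi_stdPDF_div {σ : ℝ} (hσ : 0 < σ) (x : ℝ) :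
    ∫ z in Ioi x, stdPDF (z / σ) = σ * stdCDF (-x / σ) := by
  have h := integral_comp_mul_left_Ioi stdPDF x (inv_pos.2 hσ)
  rw [inv_inv, integral_Ioi_stdPDF, smul_eq_mul] at h
  simp only [div_eq_inv_mul]
  rw [h, mul_neg]

theorem integrable_stdPDF_div {σ : ℝ} (hσ : 0 < σ) : Integrable fun z => stdPDF (z / σ) :=
  integrable_stdPDF.comp_div hσ.ne'

/-! ### The one-sided profile and its equation. -/

section profile

variable {σl σu : ℝ}

theorem profile_of_nonpos (hu : 0 < σu) {y : ℝ} (hy : y ≤ 0) :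
    profile σl σu y = 2 / (σu + σl) * (σu * stdCDF (y / σu)) := by
  rw [profile, ← neg_neg y, ← integral_Ioi_stdPDF_div hu, neg_neg]
  congr 1
  refine setIntegral_congr_fun measurableSet_Ioi fun z hz => ?_
  have : 0 ≤ z := by
    have : -y < z := hz
    linarith
  simp [this]

theorem profile_of_nonneg (hl : 0 ≤ σl) (hu : 0 < σu) {y : ℝ} (hy : 0 ≤ y) :
    profile σl σu y = 2 / (σu + σl) * (σu / 2 + σl * (stdCDF (y / σl) - 1 / 2)) := by
  rw [profile]
  congr 1
  set q : ℝ → ℝ := fun z => if 0 ≤ z then stdPDF (z / σu) else if σl = 0 then 0 else stdPDF (z / σl)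
    with hq
  have hpos : EqOn (fun z => stdPDF (z / σu)) q (Ici 0) := fun z hz => by
    have hz' : 0 ≤ z := hz
    simp [hq, hz']
  have ipos : ∫ z in Ioi 0, q z = σu / 2 := by
    rw [← setIntegral_congr_fun measurableSet_Ioi (hpos.mono Ioi_subset_Ici_self),
      integral_Ioi_stdPDF_div hu]
    simp [stdCDF_zero]
    ring
  have hint : IntegrableOn q (Ici 0) :=
    (integrable_stdPDF_div hu).integrableOn.congr_fun hpos measurableSet_Ici
  have hsplit : (Ioi (-y) : Set ℝ) =ᵐ[volume] (Ioo (-y) 0 ∪ Ici 0 : Set ℝ) := by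
    rcases hy.eq_or_lt with rfl | hy'
    · simpa using Ioi_ae_eq_Ici
    · rw [Ioo_union_Ici_eq_Ioi (by linarith : -y < 0)]
      exact EventuallyEq.rfl
  have hneg : IntegrableOn q (Ioo (-y) 0) ∧
      ∫ z in Ioo (-y) 0, q z = σl * (stdCDF (y / σl) - 1 / 2) := by
    rcases hl.eq_or_lt with rfl | hl'
    · have h0 : EqOn (fun _ => (0 : ℝ)) q (Ioo (-y) 0) := fun z hz => by
        simp [hq, not_le.2 hz.2]
      exact ⟨integrableOn_zero.congr_fun h0 measurableSet_Ioo, by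
        rw [← setIntegral_congr_fun measurableSet_Ioo h0]
        simp⟩
    · have h0 : EqOn (fun z => stdPDF (z / σl)) q (Ioo (-y) 0) := fun z hz => by
        simp [hq, not_le.2 hz.2, hl'.ne']
      refine ⟨(integrable_stdPDF_div hl').integrableOn.congr_fun h0 measurableSet_Ioo, ?_⟩
      rw [← setIntegral_congr_fun measurableSet_Ioo h0, ← integral_Ioc_eq_integral_Ioo]
      have h1 := setIntegral_union (μ := volume) (Ioc_disjoint_Ioi (le_refl (0 : ℝ)))
        measurableSet_Ioi ((integrable_stdPDF_div hl').integrableOn (s := Ioc (-y) 0))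
        ((integrable_stdPDF_div hl').integrableOn (s := Ioi 0))
      rw [Ioc_union_Ioi_eq_Ioi (by linarith), integral_Ioi_stdPDF_div hl',
        integral_Ioi_stdPDF_div hl', neg_neg, neg_zero, zero_div, stdCDF_zero] at h1
      linarith
  have hdisj : Disjoint (Ioo (-y) 0) (Ici 0) :=
    Set.disjoint_left.2 fun z hz hz' => (not_le.2 hz.2) hz'
  rw [setIntegral_congr_set hsplit, setIntegral_union hdisj measurableSet_Ici hneg.1 hint,
    integral_Ici_eq_integral_Ioi, ipos, hneg.2]
  ring

/-- One formula for both signs of `y`. It also covers `σl = 0`: the meaningless quotient by `σl` is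
multiplied by `σl`. -/
theorem profile_eq (hl : 0 ≤ σl) (hu : 0 < σu) (y : ℝ) :
    profile σl σu y = 2 / (σu + σl) *
      (σu * stdCDF (min y 0 / σu) + σl * (stdCDF (max y 0 / σl) - 1 / 2)) := by
  rcases le_total y 0 with hy | hy
  · simp [profile_of_nonpos hu hy, hy, stdCDF_zero]
  · rw [profile_of_nonneg hl hu hy, min_eq_right hy, max_eq_left hy, zero_div, stdCDF_zero]
    ring

theorem continuous_profile (hl : 0 ≤ σl) (hu : 0 < σu) : Continuous (profile σl σu) := by
  rw [funext (profile_eq hl hu)]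
  have := continuous_stdCDF
  fun_prop

theorem profile_nonneg (hl : 0 ≤ σl) (hu : 0 < σu) (y : ℝ) : 0 ≤ profile σl σu y := by
  rw [profile_eq hl hu]
  have h1 := stdCDF_nonneg (min y 0 / σu)
  have h2 : stdCDF 0 ≤ stdCDF (max y 0 / σl) := monotone_stdCDF (by positivity)
  rw [stdCDF_zero] at h2
  have h3 : 0 ≤ stdCDF (max y 0 / σl) - 1 / 2 := by linarith
  positivity

theorem profile_le_one (hl : 0 ≤ σl) (hu : 0 < σu) (y : ℝ) : profile σl σu y ≤ 1 := by
  have h1 : stdCDF (min y 0 / σu) ≤ stdCDF 0 :=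
    monotone_stdCDF (div_nonpos_of_nonpos_of_nonneg (min_le_right _ _) hu.le)
  have h2 := stdCDF_le_one (max y 0 / σl)
  rw [stdCDF_zero] at h1
  rw [profile_eq hl hu, div_mul_eq_mul_div, div_le_one (by positivity)]
  nlinarith

theorem tendsto_profile_atBot (hu : 0 < σu) : Tendsto (profile σl σu) atBot (𝓝 0) := by
  have h : Tendsto (fun y => 2 / (σu + σl) * (σu * stdCDF (y / σu))) atBot
      (𝓝 (2 / (σu + σl) * (σu * 0))) :=
    (((tendsto_cdf_atBot _).comp (tendsto_id.atBot_div_const hu)).const_mul σu).const_mul _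
  rw [mul_zero, mul_zero] at h
  exact h.congr' ((eventually_le_atBot 0).mono fun y hy => (profile_of_nonpos hu hy).symm)

theorem tendsto_profile_atTop (hl : 0 ≤ σl) (hu : 0 < σu) :
    Tendsto (profile σl σu) atTop (𝓝 1) := by
  have hlim : Tendsto (fun y => σl * (stdCDF (y / σl) - 1 / 2)) atTop (𝓝 (σl * (1 - 1 / 2))) := by
    rcases hl.eq_or_lt with rfl | hl'
    · simp
    · exact (((tendsto_cdf_atTop _).comp (tendsto_id.atTop_div_const hl')).sub_const _).const_mul _
  have h := (hlim.const_add (σu / 2)).const_mul (2 / (σu + σl))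
  have e : 2 / (σu + σl) * (σu / 2 + σl * (1 - 1 / 2)) = 1 := by
    field_simp
    ring
  rw [e] at h
  exact h.congr' ((eventually_ge_atTop 0).mono fun y hy => (profile_of_nonneg hl hu hy).symm)

/-- The lower volatility enters the formula through `ε` times a bounded factor and through the
normalising constant, so no limit of `Φ(y/ε)` is needed. This serves the passage to `σl = 0`. -/
theorem tendsto_profile_left (hu : 0 < σu) (y : ℝ) :
    Tendsto (fun ε => profile ε σu y) (𝓝[>] 0) (𝓝 (profile 0 σu y)) := by
  have hid : Tendsto (fun ε : ℝ => ε) (𝓝[>] 0) (𝓝 0) := tendsto_id.mono_left nhdsWithin_le_nhds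
  have h1 : Tendsto (fun ε : ℝ => ε * (stdCDF (max y 0 / ε) - 1 / 2)) (𝓝[>] 0) (𝓝 0) := by
    refine hid.zero_mul_isBoundedUnder_le (isBoundedUnder_of ⟨1, fun ε => ?_⟩)
    have h1 := stdCDF_nonneg (max y 0 / ε)
    have h2 := stdCDF_le_one (max y 0 / ε)
    simp only [Function.comp, Real.norm_eq_abs]
    rw [abs_le]
    constructor <;> linarith
  have h2 : Tendsto (fun ε : ℝ => 2 / (σu + ε)) (𝓝[>] 0) (𝓝 (2 / (σu + 0))) :=
    tendsto_const_nhds.div (hid.const_add σu) (by simpa using hu.ne')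
  have h3 := h2.mul (h1.const_add (σu * stdCDF (min y 0 / σu)))
  rw [profile_eq le_rfl hu, zero_mul]
  exact h3.congr' (eventually_mem_nhdsWithin.mono fun ε hε => (profile_eq (le_of_lt hε) hu y).symm)

/-- Gluing at `0`, applied to the profile and to its derivative; this makes the profile `C²`
although the volatility switches there. -/
theorem hasDerivAt_ite_nonpos {f g : ℝ → ℝ} {f' g' : ℝ → ℝ} (hf : ∀ y, HasDerivAt f (f' y) y)
    (hg : ∀ y, HasDerivAt g (g' y) y) (h0 : f 0 = g 0) (h0' : f' 0 = g' 0) (y : ℝ) :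
    HasDerivAt (fun y => if y ≤ 0 then f y else g y) (if y ≤ 0 then f' y else g' y) y := by
  rcases lt_trichotomy y 0 with hy | rfl | hy
  · rw [if_pos hy.le]
    refine (hf y).congr_of_eventuallyEq ?_
    filter_upwards [Iio_mem_nhds hy] with z hz
    exact if_pos (le_of_lt hz)
  · rw [if_pos le_rfl]
    have h1 : HasDerivWithinAt (fun y => if y ≤ 0 then f y else g y) (f' 0) (Iic 0) 0 :=
      (hf 0).hasDerivWithinAt.congr (fun z hz => if_pos hz) (if_pos le_rfl)
    have h2 : HasDerivWithinAt (fun y => if y ≤ 0 then f y else g y) (f' 0) (Ici 0) 0 := by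
      rw [h0']
      refine (hg 0).hasDerivWithinAt.congr (fun z hz => ?_) (by simp [h0])
      rcases (mem_Ici.1 hz).eq_or_lt with rfl | hz'
      · simp [h0]
      · exact if_neg (not_le.2 hz')
    have := h1.union h2
    rwa [Iic_union_Ici, hasDerivWithinAt_univ] at this
  · rw [if_neg (not_le.2 hy)]
    refine (hg y).congr_of_eventuallyEq ?_
    filter_upwards [Ioi_mem_nhds hy] with z hz
    exact if_neg (not_le.2 hz)

theorem hasDerivAt_stdCDF_div (σ y : ℝ) :
    HasDerivAt (fun y => stdCDF (y / σ)) (stdPDF (y / σ) / σ) y := by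
  refine ((hasDerivAt_stdCDF (y / σ)).comp y ((hasDerivAt_id y).div_const σ)).congr_deriv ?_
  ring

theorem hasDerivAt_stdPDF_div (σ y : ℝ) :
    HasDerivAt (fun y => stdPDF (y / σ)) (-y / σ ^ 2 * stdPDF (y / σ)) y := by
  refine ((hasDerivAt_stdPDF (y / σ)).comp y ((hasDerivAt_id y).div_const σ)).congr_deriv ?_
  ring

/-- The first derivative of the profile, for `σl > 0`. -/
noncomputable def profileDeriv (σl σu y : ℝ) : ℝ :=
  2 / (σu + σl) * if y ≤ 0 then stdPDF (y / σu) else stdPDF (y / σl)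

/-- The second derivative of the profile, for `σl > 0`. -/
noncomputable def profileDeriv2 (σl σu y : ℝ) : ℝ :=
  2 / (σu + σl) * if y ≤ 0 then -y / σu ^ 2 * stdPDF (y / σu) else -y / σl ^ 2 * stdPDF (y / σl)

theorem hasDerivAt_profile (hl : 0 < σl) (hu : 0 < σu) (y : ℝ) :
    HasDerivAt (profile σl σu) (profileDeriv σl σu y) y := by
  have h : profile σl σu = fun y => 2 / (σu + σl) * if y ≤ 0 then σu * stdCDF (y / σu) else
      σu / 2 + σl * (stdCDF (y / σl) - 1 / 2) := by
    funext y
    split_ifs with hy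
    · exact profile_of_nonpos hu hy
    · exact profile_of_nonneg hl.le hu (not_le.1 hy).le
  rw [h]
  refine (hasDerivAt_ite_nonpos (f' := fun y => stdPDF (y / σu)) (g' := fun y => stdPDF (y / σl))
    (fun z => ?_) (fun z => ?_) ?_ ?_ y).const_mul _
  · refine ((hasDerivAt_stdCDF_div σu z).const_mul σu).congr_deriv ?_
    field_simp
  · refine ((((hasDerivAt_stdCDF_div σl z).sub_const _).const_mul σl).const_add _).congr_deriv ?_
    field_simp
  · simp [stdCDF_zero]
    ring
  · simp

theorem hasDerivAt_profileDeriv (y : ℝ) :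
    HasDerivAt (profileDeriv σl σu) (profileDeriv2 σl σu y) y :=
  (hasDerivAt_ite_nonpos (hasDerivAt_stdPDF_div σu) (hasDerivAt_stdPDF_div σl)
    (by simp) (by simp) y).const_mul _

theorem continuous_profileDeriv2 : Continuous (profileDeriv2 σl σu) := by
  have := continuous_stdPDF
  refine continuous_const.mul (Continuous.if_le (by fun_prop) (by fun_prop) continuous_id
    continuous_const ?_)
  rintro y rfl
  simp

/-- With its counterpart for `y ≥ 0`, this is the profile equation `G(f'') = -y f'/2`: the sign of
`f''` selects the volatility. -/
theorem profileDeriv2_of_nonpos (hl : 0 ≤ σl) (hu : 0 < σu) {y : ℝ} (hy : y ≤ 0) :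
    0 ≤ profileDeriv2 σl σu y ∧
      -y * profileDeriv σl σu y / 2 = σu ^ 2 / 2 * profileDeriv2 σl σu y := by
  have h1 := (stdPDF_pos (y / σu)).le
  have h2 : 0 ≤ -y := by linarith
  simp only [profileDeriv, profileDeriv2, if_pos hy]
  refine ⟨by positivity, ?_⟩
  field_simp

theorem profileDeriv2_of_nonneg (hl : 0 < σl) (hu : 0 < σu) {y : ℝ} (hy : 0 ≤ y) :
    profileDeriv2 σl σu y ≤ 0 ∧
      -y * profileDeriv σl σu y / 2 = σl ^ 2 / 2 * profileDeriv2 σl σu y := by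
  rcases hy.eq_or_lt with rfl | hy'
  · simp [profileDeriv2]
  have h1 := (stdPDF_pos (y / σl)).le
  simp only [profileDeriv, profileDeriv2, if_neg (not_le.2 hy')]
  constructor
  · have : 0 ≤ 2 / (σu + σl) * (y / σl ^ 2 * stdPDF (y / σl)) := by positivity
    linear_combination this
  · field_simp

end profile

/-! ### The nonlinearity. -/

section gFun

variable {σl σu : ℝ}

/-- As a maximum of two linear functions, `G` is sublinear; the remaining properties rest on this.
-/
theorem gFun_eq_max (hl : 0 ≤ σl) (hlu : σl ≤ σu) (a : ℝ) :
    gFun σl σu a = max (σu ^ 2 / 2 * a) (σl ^ 2 / 2 * a) := by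
  have h : σl ^ 2 ≤ σu ^ 2 := pow_le_pow_left₀ hl hlu 2
  rcases le_total 0 a with ha | ha
  · rw [gFun, posPart_eq_self.2 ha, negPart_eq_zero.2 ha, max_eq_left (by nlinarith)]
    ring
  · rw [gFun, posPart_eq_zero.2 ha, negPart_eq_neg.2 ha, max_eq_right (by nlinarith)]
    ring

theorem upper_mul_le_gFun (hl : 0 ≤ σl) (hlu : σl ≤ σu) (a : ℝ) : σu ^ 2 / 2 * a ≤ gFun σl σu a :=
  (le_max_left _ _).trans_eq (gFun_eq_max hl hlu a).symm

theorem lower_mul_le_gFun (hl : 0 ≤ σl) (hlu : σl ≤ σu) (a : ℝ) : σl ^ 2 / 2 * a ≤ gFun σl σu a :=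
  (le_max_right _ _).trans_eq (gFun_eq_max hl hlu a).symm

theorem gFun_add_le (hl : 0 ≤ σl) (hlu : σl ≤ σu) (a b : ℝ) :
    gFun σl σu (a + b) ≤ gFun σl σu a + gFun σl σu b := by
  have h1 := upper_mul_le_gFun hl hlu a
  have h2 := upper_mul_le_gFun hl hlu b
  have h3 := lower_mul_le_gFun hl hlu a
  have h4 := lower_mul_le_gFun hl hlu b
  rw [gFun_eq_max hl hlu (a + b)]
  exact max_le (by linarith) (by linarith)

theorem gFun_of_nonneg (hl : 0 ≤ σl) (hlu : σl ≤ σu) {a : ℝ} (ha : 0 ≤ a) :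
    gFun σl σu a = σu ^ 2 / 2 * a := by
  have h : σl ^ 2 ≤ σu ^ 2 := pow_le_pow_left₀ hl hlu 2
  rw [gFun_eq_max hl hlu, max_eq_left (by nlinarith)]

theorem gFun_of_nonpos (hl : 0 ≤ σl) (hlu : σl ≤ σu) {a : ℝ} (ha : a ≤ 0) :
    gFun σl σu a = σl ^ 2 / 2 * a := by
  have h : σl ^ 2 ≤ σu ^ 2 := pow_le_pow_left₀ hl hlu 2
  rw [gFun_eq_max hl hlu, max_eq_right (by nlinarith)]

theorem gFun_add_le_of_nonneg (hl : 0 ≤ σl) (hlu : σl ≤ σu) (a : ℝ) {b : ℝ} (hb : 0 ≤ b) :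
    gFun σl σu (a + b) ≤ gFun σl σu a + σu ^ 2 / 2 * b :=
  (gFun_add_le hl hlu a b).trans_eq (by rw [gFun_of_nonneg hl hlu hb])

theorem gFun_div (hl : 0 ≤ σl) (hlu : σl ≤ σu) (a : ℝ) {t : ℝ} (ht : 0 < t) :
    gFun σl σu (a / t) = gFun σl σu a / t := by
  rw [gFun_eq_max hl hlu, gFun_eq_max hl hlu, ← max_div_div_right ht.le]
  congr 1 <;> ring

theorem gFun_anti_lower {σ : ℝ} (hl : 0 ≤ σ) (h : σ ≤ σl) (hlu : σl ≤ σu) (a : ℝ) :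
    gFun σl σu a ≤ gFun σ σu a := by
  have h1 : σ ^ 2 ≤ σl ^ 2 := pow_le_pow_left₀ hl h 2
  rcases le_total 0 a with ha | ha
  · rw [gFun_of_nonneg (hl.trans h) hlu ha, gFun_of_nonneg hl (h.trans hlu) ha]
  · rw [gFun_of_nonpos (hl.trans h) hlu ha, gFun_of_nonpos hl (h.trans hlu) ha]
    nlinarith

end gFun

/-! ### Self-similar solutions: touching functions and behaviour as `t ↓ 0`. -/

/-- Every point of the graph of the profile is touched from above by a classical supersolution of
the profile equation. -/
theorem exists_touching_profile {σl σu : ℝ} (hl : 0 ≤ σl) (hlu : σl ≤ σu) (hu : 0 < σu) (y₀ : ℝ) :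
    ∃ h h' h'' : ℝ → ℝ, (∀ y, HasDerivAt h (h' y) y) ∧ (∀ y, HasDerivAt h' (h'' y) y) ∧
      Continuous h'' ∧ (∀ y, profile σl σu y ≤ h y) ∧ h y₀ = profile σl σu y₀ ∧
      gFun σl σu (h'' y₀) ≤ -y₀ * h' y₀ / 2 := by
  rcases hl.eq_or_lt with rfl | hl'
  -- For `σl = 0` the profile is `min(1, 2Φ(y/σu))`, with a concave kink at `0`; either branch
  -- touches it from above. For `σl > 0` the profile touches itself.
  · have hpos : ∀ y, 0 ≤ y → profile 0 σu y = 1 := fun y hy => by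
      rw [profile_of_nonneg le_rfl hu hy]
      field_simp
      ring
    rcases le_total y₀ 0 with hy | hy
    · refine ⟨fun y => 2 * stdCDF (y / σu), fun y => 2 * (stdPDF (y / σu) / σu),
        fun y => 2 * (-y / σu ^ 2 * stdPDF (y / σu) / σu),
        fun y => (hasDerivAt_stdCDF_div σu y).const_mul 2,
        fun y => ((hasDerivAt_stdPDF_div σu y).div_const σu).const_mul 2, ?_, fun y => ?_, ?_, ?_⟩
      · have := continuous_stdPDF
        fun_prop
      · rcases le_total y 0 with hy | hy
        · rw [profile_of_nonpos hu hy]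
          field_simp
          simp
        · have h1 : stdCDF 0 ≤ stdCDF (y / σu) := monotone_stdCDF (by positivity)
          rw [stdCDF_zero] at h1
          rw [hpos y hy]
          linarith
      · rw [profile_of_nonpos hu hy]
        field_simp
        rw [add_zero, mul_comm]
      · have h1 := (stdPDF_pos (y₀ / σu)).le
        have h2 : 0 ≤ -y₀ := by linarith
        rw [gFun_of_nonneg le_rfl hlu (by positivity)]
        refine le_of_eq ?_
        field_simp
    · refine ⟨fun _ => 1, fun _ => 0, fun _ => 0, fun y => hasDerivAt_const _ _,
        fun y => hasDerivAt_const _ _, continuous_const, profile_le_one le_rfl hu,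
        (hpos y₀ hy).symm, ?_⟩
      rw [gFun_of_nonneg le_rfl hlu le_rfl]
      simp
  · refine ⟨profile σl σu, _, _, hasDerivAt_profile hl' hu, hasDerivAt_profileDeriv,
      continuous_profileDeriv2, fun _ => le_rfl, rfl, ?_⟩
    rcases le_total y₀ 0 with hy | hy
    · obtain ⟨h1, h2⟩ := profileDeriv2_of_nonpos hl hu hy
      rw [gFun_of_nonneg hl hlu h1, h2]
    · obtain ⟨h1, h2⟩ := profileDeriv2_of_nonneg hl' hu hy
      rw [gFun_of_nonpos hl hlu h1, h2]

theorem continuousOn_selfSimilar {h : ℝ → ℝ} (hh : Continuous h) (e d : ℝ) :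
    ContinuousOn (fun p : ℝ × ℝ => h ((e * p.2 - d) / √p.1)) {p | 0 < p.1} :=
  hh.comp_continuousOn (ContinuousOn.div (by fun_prop) (by fun_prop)
    fun _ hp => (Real.sqrt_pos.2 hp).ne')

theorem tendsto_inv_sqrt_time (x : ℝ) :
    Tendsto (fun p : ℝ × ℝ => (√p.1)⁻¹) (𝓝[{p : ℝ × ℝ | 0 < p.1}] ((0 : ℝ), x)) atTop := by
  refine tendsto_inv_nhdsGT_zero.comp (tendsto_nhdsWithin_iff.2 ⟨?_, ?_⟩)
  · have : Continuous fun p : ℝ × ℝ => √p.1 := by fun_prop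
    simpa using (this.tendsto ((0 : ℝ), x)).mono_left nhdsWithin_le_nhds
  · exact eventually_mem_nhdsWithin.mono fun p hp => Real.sqrt_pos.2 hp

theorem tendsto_selfSimilar_atTop {e d x : ℝ} (h : d < e * x) :
    Tendsto (fun p : ℝ × ℝ => (e * p.2 - d) / √p.1) (𝓝[{p : ℝ × ℝ | 0 < p.1}] ((0 : ℝ), x))
      atTop := by
  have hc : Continuous fun p : ℝ × ℝ => e * p.2 - d := by fun_prop
  exact ((hc.tendsto ((0 : ℝ), x)).mono_left nhdsWithin_le_nhds).pos_mul_atTop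
    (sub_pos.2 h) (tendsto_inv_sqrt_time x)

theorem tendsto_selfSimilar_atBot {e d x : ℝ} (h : e * x < d) :
    Tendsto (fun p : ℝ × ℝ => (e * p.2 - d) / √p.1) (𝓝[{p : ℝ × ℝ | 0 < p.1}] ((0 : ℝ), x))
      atBot := by
  have hc : Continuous fun p : ℝ × ℝ => e * p.2 - d := by fun_prop
  exact ((hc.tendsto ((0 : ℝ), x)).mono_left nhdsWithin_le_nhds).neg_mul_atTop
    (sub_neg.2 h) (tendsto_inv_sqrt_time x)

/-! ### Upper barrier. -/

/-- The sum `u + v` of the two one-sided solutions at positive times. -/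
noncomputable def twoSided (σl σu c t x : ℝ) : ℝ :=
  profile σl σu ((1 * x - c) / √t) + profile σl σu ((-1 * x - c) / √t)

section barriers

variable {σl σu : ℝ}

theorem twoSided_nonneg (hl : 0 ≤ σl) (hu : 0 < σu) (c t x : ℝ) : 0 ≤ twoSided σl σu c t x :=
  add_nonneg (profile_nonneg hl hu _) (profile_nonneg hl hu _)

theorem twoSided_le_two (hl : 0 ≤ σl) (hu : 0 < σu) (c t x : ℝ) : twoSided σl σu c t x ≤ 2 :=
  (add_le_add (profile_le_one hl hu _) (profile_le_one hl hu _)).trans_eq (by norm_num)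

theorem continuousOn_twoSided (hl : 0 ≤ σl) (hu : 0 < σu) (c : ℝ) :
    ContinuousOn (fun p : ℝ × ℝ => twoSided σl σu c p.1 p.2) {p | 0 < p.1} :=
  (continuousOn_selfSimilar (continuous_profile hl hu) 1 c).add
    (continuousOn_selfSimilar (continuous_profile hl hu) (-1) c)

theorem twoSided_touching (hl : 0 ≤ σl) (hlu : σl ≤ σu) (hu : 0 < σu) (c : ℝ) {t : ℝ} (ht : 0 < t)
    (x : ℝ) : ∃ (ψ : ℝ × ℝ → ℝ) (a b : ℝ), HasHeatJet ψ t x a b ∧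
      (∀ p : ℝ × ℝ, twoSided σl σu c p.1 p.2 ≤ ψ p) ∧ ψ (t, x) = twoSided σl σu c t x ∧
      gFun σl σu b ≤ a := by
  obtain ⟨h₁, h₁', h₁'', d₁, d₁', c₁, le₁, eq₁, g₁⟩ :=
    exists_touching_profile hl hlu hu ((1 * x - c) / √t)
  obtain ⟨h₂, h₂', h₂'', d₂, d₂', c₂, le₂, eq₂, g₂⟩ :=
    exists_touching_profile hl hlu hu ((-1 * x - c) / √t)
  refine ⟨_, _, _, (hasHeatJet_selfSimilar d₁ d₁' c₁ 1 c x ht).add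
    (hasHeatJet_selfSimilar d₂ d₂' c₂ (-1) c x ht), fun p => add_le_add (le₁ _) (le₂ _),
    congrArg₂ (· + ·) eq₁ eq₂, ?_⟩
  refine (gFun_add_le hl hlu _ _).trans (add_le_add ?_ ?_)
  · rw [one_pow, one_mul, gFun_div hl hlu _ ht, ← div_div]
    gcongr
  · rw [neg_one_sq, one_mul, gFun_div hl hlu _ ht, ← div_div]
    gcongr

/-- Because `c' < c`, at every point with `|x| ≥ c` one of the two profiles tends to `1` as `t ↓ 0`,
even where the datum jumps; where `|x| < c`, nonnegativity is enough. -/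
theorem IsGHeatSolution.le_twoSided {c : ℝ} {w : ℝ → ℝ → ℝ} (hl : 0 ≤ σl) (hlu : σl ≤ σu)
    (hu : 0 < σu) (hw : IsGHeatSolution σl σu ({x : ℝ | c < |x|}.indicator 1) w) {c' : ℝ}
    (hc : c' < c) {t : ℝ} (ht : 0 < t) (x : ℝ) : w t x ≤ twoSided σl σu c' t x := by
  refine viscosity_comparison (G := gFun σl σu) (L := σu ^ 2 / 2) (by positivity)
    (fun a b hb => gFun_add_le_of_nonneg hl hlu a hb) hw.continuousOn
    (continuousOn_twoSided hl hu c') ?_ ?_ ?_ ?_ ht x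
  · intro ψ t x a b ht hψ hmax
    simpa only [hψ.time, hψ.space] using hw.sub ψ t x ht hψ.contDiffAt hmax
  · intro t x ht
    obtain ⟨ψ, a, b, h1, h2, h3, h4⟩ := twoSided_touching hl hlu hu c' ht x
    exact ⟨ψ, a, b, h1, .of_forall h2, h3, h4⟩
  · intro x ε hε
    rcases lt_or_ge |x| c with hx | hx
    · have hev : ∀ᶠ y in 𝓝 x, {x : ℝ | c < |x|}.indicator (1 : ℝ → ℝ) y ≤ 0 := by
        filter_upwards [continuous_abs.continuousAt.eventually_lt_const hx] with y hy
        exact (indicator_of_notMem (show y ∉ {x : ℝ | c < |x|} from not_lt.2 hy.le) (1 : ℝ → ℝ)).le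
      filter_upwards [hw.limsup_le x 0 hev ε hε] with p hp
      linarith [twoSided_nonneg hl hu c' p.1 p.2]
    · have hev : ∀ᶠ y in 𝓝 x, {x : ℝ | c < |x|}.indicator (1 : ℝ → ℝ) y ≤ 1 :=
        .of_forall fun y =>
        indicator_apply_le' (fun _ => le_rfl) (fun _ => zero_le_one (α := ℝ))
      have hlim : ∀ {e : ℝ}, c' < e * x →
          ∀ᶠ p in 𝓝[{p : ℝ × ℝ | 0 < p.1}] ((0 : ℝ), x),
            1 - ε / 2 < profile σl σu ((e * p.2 - c') / √p.1) := fun h =>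
        ((tendsto_profile_atTop hl hu).comp (tendsto_selfSimilar_atTop h)).eventually_const_lt
          (by linarith)
      have hsum : ∀ᶠ p in 𝓝[{p : ℝ × ℝ | 0 < p.1}] ((0 : ℝ), x),
          1 - ε / 2 < twoSided σl σu c' p.1 p.2 := by
        rcases le_abs.1 hx with h | h
        · filter_upwards [hlim (e := 1) (by linarith)] with p hp
          exact lt_add_of_lt_of_nonneg hp (profile_nonneg hl hu _)
        · filter_upwards [hlim (e := -1) (by linarith)] with p hp
          exact lt_add_of_nonneg_of_lt (profile_nonneg hl hu _) hp
      filter_upwards [hw.limsup_le x 1 hev (ε / 2) (by positivity), hsum] with p hp h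
      linarith
  · intro T hT
    obtain ⟨C, k, hC⟩ := hw.growth T hT
    refine ⟨C, k, fun t ht x => ?_⟩
    have := (le_abs_self _).trans (hC t ⟨ht.1.le, ht.2.le⟩ x)
    linarith [twoSided_nonneg hl hu c' t x]

/-! ### Lower barrier. -/

/-- The amount by which the lower barrier stays below `u + v` at distance `z ≥ c` from the origin. The
second term solves the heat equation with volatility `σl` and cancels the jump of the slope at `c`. -/
noncomputable def barrierGap (σl σu c t z : ℝ) : ℝ :=
  2 / (σu + σl) * (σu * stdCDF ((-1 * z - c) / √t / σu) -
    σl * stdCDF ((-1 / σl * z - (2 * c / σu - c / σl)) / √t))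

/-- The second `Φ` has both the smaller argument, since `(z - c)/σl ≥ (z - c)/σu`, and the smaller
weight. Hence at small times the lower barrier need only be compared through `u + v`. -/
theorem barrierGap_nonneg (hl : 0 < σl) (hlu : σl ≤ σu) {c z : ℝ} (t : ℝ) (hz : c ≤ z) :
    0 ≤ barrierGap σl σu c t z := by
  have hu : 0 < σu := hl.trans_le hlu
  have h1 : (z - c) / σu ≤ (z - c) / σl := div_le_div_of_nonneg_left (sub_nonneg.2 hz) hl hlu
  have h2 : stdCDF ((-1 / σl * z - (2 * c / σu - c / σl)) / √t) ≤
      stdCDF ((-1 * z - c) / √t / σu) := by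
    refine monotone_stdCDF ?_
    rw [div_right_comm]
    refine div_le_div_of_nonneg_right ?_ (Real.sqrt_nonneg t)
    have e1 : -1 / σl * z - (2 * c / σu - c / σl) = -((z - c) / σl) - 2 * c / σu := by ring
    have e2 : (-1 * z - c) / σu = -((z - c) / σu) - 2 * c / σu := by ring
    rw [e1, e2]
    linarith
  have h3 := stdCDF_nonneg ((-1 / σl * z - (2 * c / σu - c / σl)) / √t)
  refine mul_nonneg (by positivity) (sub_nonneg.2 ?_)
  gcongr

/-- Both arguments equal `-2c/(σu√t)` at `z = c`. The factor `0 *` puts the result in the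
self-similar form with `e = 0`. -/
theorem barrierGap_self (c t : ℝ) :
    barrierGap σl σu c t c =
      2 / (σu + σl) * (σu - σl) * stdCDF ((0 * c - 2 * c / σu) / √t) := by
  have e1 : (-1 * c - c) / √t / σu = (0 * c - 2 * c / σu) / √t := by ring
  have e2 : (-1 / σl * c - (2 * c / σu - c / σl)) / √t = (0 * c - 2 * c / σu) / √t := by ring
  rw [barrierGap, e1, e2]
  ring

/-- Jensen's inequality for the concave `Φ` on `[0, ∞)`: `(z + c)/(σu√t)` is the mean of `A₀` and
`A` with weights `1 - σl/σu` and `σl/σu`. Thus the spatially constant gap gives a global touching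
function, also at `|x| = c`, besides the final error bound. -/
theorem barrierGap_le (hl : 0 < σl) (hlu : σl ≤ σu) {c z : ℝ} (hc : 0 ≤ c) (t x : ℝ)
    (hz : c ≤ z) : barrierGap σl σu c t z ≤
      2 / (σu + σl) * (σu - σl) * stdCDF ((0 * x - 2 * c / σu) / √t) := by
  have hu : 0 < σu := hl.trans_le hlu
  have hs := Real.sqrt_nonneg t
  set A₀ := 2 * c / σu / √t with hA₀
  set A := ((z - c) / σl + 2 * c / σu) / √t with hA
  have hθ : σl / σu ≤ 1 := (div_le_one hu).2 hlu
  have h := concaveOn_stdCDF.2 (show 0 ≤ A₀ by positivity)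
    (show 0 ≤ A by have := sub_nonneg.2 hz; positivity) (sub_nonneg.2 hθ)
    (show 0 ≤ σl / σu by positivity) (by ring)
  simp only [smul_eq_mul] at h
  have e0 : (1 - σl / σu) * A₀ + σl / σu * A = (z + c) / √t / σu := by
    rw [hA₀, hA]
    have : σl / σu * ((z - c) / σl) = (z - c) / σu := by field_simp
    linear_combination this / √t
  have e1 : (-1 * z - c) / √t / σu = -((z + c) / √t / σu) := by ring
  have e2 : (-1 / σl * z - (2 * c / σu - c / σl)) / √t = -A := by
    rw [hA]
    ring
  have e3 : (0 * x - 2 * c / σu) / √t = -A₀ := by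
    rw [hA₀]
    ring
  rw [barrierGap, e1, e2, e3, stdCDF_neg, stdCDF_neg, stdCDF_neg, mul_assoc, ← e0]
  gcongr
  have h' := mul_le_mul_of_nonneg_left h hu.le
  have e4 : σu * ((1 - σl / σu) * stdCDF A₀ + σl / σu * stdCDF A) =
      (σu - σl) * stdCDF A₀ + σl * stdCDF A := by field_simp
  rw [e4] at h'
  linarith

theorem continuousOn_barrierGap (c : ℝ) : ContinuousOn
    (fun p : ℝ × ℝ => barrierGap σl σu c p.1 (max |p.2| c)) {p | 0 < p.1} := by
  have h1 := continuous_stdCDF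
  have h2 : ContinuousOn (fun p : ℝ × ℝ => √p.1) {p | 0 < p.1} := by fun_prop
  have h3 : ∀ p ∈ {p : ℝ × ℝ | 0 < p.1}, √p.1 ≠ 0 := fun p hp => (Real.sqrt_pos.2 hp).ne'
  refine continuousOn_const.mul ((continuousOn_const.mul (h1.comp_continuousOn ?_)).sub
    (continuousOn_const.mul (h1.comp_continuousOn ?_)))
  · exact (ContinuousOn.div (by fun_prop) h2 h3).div_const σu
  · exact ContinuousOn.div (by fun_prop) h2 h3

theorem twoSided_eq_of_eq_one_or_neg_one {e : ℝ} (he : e = 1 ∨ e = -1) (c t x : ℝ) :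
    twoSided σl σu c t x =
      profile σl σu ((e * x - c) / √t) + profile σl σu ((-1 * (e * x) - c) / √t) := by
  rcases he with rfl | rfl
  · simp [twoSided]
  · simp [twoSided, add_comm]

/-- The touching function at the points with `|x| ≤ c`. -/
theorem lowerBarrier_touching_inner (hl : 0 < σl) (hlu : σl ≤ σu) {c : ℝ} (hc : 0 < c) {t x : ℝ}
    (ht : 0 < t) (hx : |x| ≤ c) : ∃ (ψ : ℝ × ℝ → ℝ) (a b : ℝ), HasHeatJet ψ t x a b ∧
      (∀ p : ℝ × ℝ,
        -(twoSided σl σu c p.1 p.2 - barrierGap σl σu c p.1 (max |p.2| c)) ≤ ψ p) ∧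
      ψ (t, x) = -(twoSided σl σu c t x - barrierGap σl σu c t (max |x| c)) ∧
      -gFun σl σu (-b) ≤ a := by
  have hu : 0 < σu := hl.trans_le hlu
  have hs := Real.sqrt_pos.2 ht
  have hx1 := (abs_le.1 hx).1
  have hx2 := (abs_le.1 hx).2
  have jet := fun e : ℝ => hasHeatJet_selfSimilar (hasDerivAt_profile hl hu)
    hasDerivAt_profileDeriv continuous_profileDeriv2 e c x ht
  have jetB := hasHeatJet_selfSimilar hasDerivAt_stdCDF hasDerivAt_stdPDF
    continuous_neg_mul_stdPDF 0 (2 * c / σu) x ht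
  refine ⟨_, _, _, (((jet 1).add (jet (-1))).sub
    (jetB.const_mul (2 / (σu + σl) * (σu - σl)))).neg, fun p => ?_, ?_, ?_⟩
  · have := barrierGap_le hl hlu hc.le p.1 p.2 (le_max_right |p.2| c)
    simp only [twoSided]
    linarith
  · have := barrierGap_self (σl := σl) (σu := σu) c t
    rw [zero_mul] at this
    simp only [twoSided, max_eq_right hx, this, zero_mul]
  · have h1 := profileDeriv2_of_nonpos hl.le hu (y := (1 * x - c) / √t)
      (div_nonpos_of_nonpos_of_nonneg (by linarith) hs.le)
    have h2 := profileDeriv2_of_nonpos hl.le hu (y := (-1 * x - c) / √t)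
      (div_nonpos_of_nonpos_of_nonneg (by linarith) hs.le)
    have hk : 0 ≤ 2 / (σu + σl) * (σu - σl) := by
      have := sub_nonneg.2 hlu
      positivity
    -- The subtracted gap increases in time, which only lowers the time derivative of the barrier;
    -- it contributes nothing to the second space derivative.
    have hB : 0 ≤ 2 / (σu + σl) * (σu - σl) * (-((0 * x - 2 * c / σu) / √t) *
        stdPDF ((0 * x - 2 * c / σu) / √t) / (2 * t)) := by
      have h3 := (stdPDF_pos ((0 * x - 2 * c / σu) / √t)).le
      have h4 : 0 ≤ -((0 * x - 2 * c / σu) / √t) := by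
        rw [← neg_div, zero_mul, zero_sub, neg_neg]
        positivity
      positivity
    rw [neg_neg, neg_le_neg_iff, ← div_div, ← div_div, h1.2, h2.2]
    refine le_trans ?_ (upper_mul_le_gFun hl.le hlu _)
    refine (sub_le_self _ hB).trans_eq ?_
    ring

/-- The touching function at the points with `|x| > c`. -/
theorem lowerBarrier_touching_outer (hl : 0 < σl) (hlu : σl ≤ σu) {c : ℝ} (hc : 0 < c)
    {e t x : ℝ} (ht : 0 < t) (he : e = 1 ∨ e = -1) (hx : c < e * x) :
    ∃ (ψ : ℝ × ℝ → ℝ) (a b : ℝ), HasHeatJet ψ t x a b ∧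
      (∀ᶠ p in 𝓝 (t, x),
        -(twoSided σl σu c p.1 p.2 - barrierGap σl σu c p.1 (max |p.2| c)) = ψ p) ∧
      -gFun σl σu (-b) ≤ a := by
  have hu : 0 < σu := hl.trans_le hlu
  have hs := Real.sqrt_pos.2 ht
  have he2 : e ^ 2 = 1 := by rcases he with rfl | rfl <;> norm_num
  have jet := hasHeatJet_selfSimilar (hasDerivAt_profile hl hu)
    hasDerivAt_profileDeriv continuous_profileDeriv2 e c x ht
  have jetg := hasHeatJet_selfSimilar hasDerivAt_stdCDF hasDerivAt_stdPDF
    continuous_neg_mul_stdPDF (-1 / σl * e) (2 * c / σu - c / σl) x ht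
  refine ⟨_, _, _, (jet.add (jetg.const_mul (2 / (σu + σl) * σl))).neg, ?_, ?_⟩
  · have hopen : ∀ᶠ p : ℝ × ℝ in 𝓝 (t, x), c < e * p.2 := by
      have : ContinuousAt (fun p : ℝ × ℝ => e * p.2) (t, x) := by fun_prop
      exact this.eventually_const_lt hx
    filter_upwards [hopen] with p hp
    have habs : |p.2| = e * p.2 := by
      rw [← abs_of_pos (hc.trans hp), abs_mul]
      rcases he with rfl | rfl <;> simp
    have hneg : (-1 * (e * p.2) - c) / √p.1 ≤ 0 :=
      div_nonpos_of_nonpos_of_nonneg (by linarith) (Real.sqrt_nonneg _)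
    -- The far summand has a negative argument, so it is exactly the first term of the gap and
    -- cancels; what remains has volatility `σl` throughout.
    rw [habs, max_eq_left hp.le, twoSided_eq_of_eq_one_or_neg_one he, profile_of_nonpos hu hneg,
      barrierGap, mul_assoc (-1 / σl)]
    ring
  · have h1 := profileDeriv2_of_nonneg hl hu (y := (e * x - c) / √t)
      (div_nonneg (by linarith) hs.le)
    rw [neg_neg, neg_le_neg_iff, ← div_div, h1.2]
    refine le_trans (le_of_eq ?_) (lower_mul_le_gFun hl.le hlu _)
    rw [mul_pow, he2]
    field_simp

/-- The volatility `σ₀` of the equation for `w` is kept apart from `σl`, so that a solution with `σ₀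
= 0` can be tested against barriers with `σl > 0`. -/
theorem IsGHeatSolution.twoSided_sub_le {σ₀ c : ℝ} {w : ℝ → ℝ → ℝ} (hl : 0 < σl) (hlu : σl ≤ σu)
    (hw : IsGHeatSolution σ₀ σu ({x : ℝ | c < |x|}.indicator 1) w)
    (hsup : IsGHeatSupersolution σl σu w) (hc : 0 < c) {c' : ℝ} (hc' : c < c') {t : ℝ} (ht : 0 < t)
    (x : ℝ) : twoSided σl σu c' t x - w t x ≤
      2 / (σu + σl) * (σu - σl) * stdCDF ((0 * x - 2 * c' / σu) / √t) := by
  have hu : 0 < σu := hl.trans_le hlu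
  have hc0 : 0 < c' := hc.trans hc'
  have hgap := fun t x : ℝ => barrierGap_nonneg hl hlu t (le_max_right |x| c')
  suffices H : -w t x ≤ -(twoSided σl σu c' t x - barrierGap σl σu c' t (max |x| c')) by
    have := barrierGap_le hl hlu hc0.le t x (le_max_right |x| c')
    linarith
  -- Both functions are negated, which turns the supersolution `w` into a subsolution for `-G(-·)`.
  refine viscosity_comparison (G := fun a => -gFun σl σu (-a)) (L := σu ^ 2 / 2)
    (w := fun t x => -w t x)
    (U := fun t x => -(twoSided σl σu c' t x - barrierGap σl σu c' t (max |x| c')))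
    (by positivity) ?_ hw.continuousOn.neg
    ((continuousOn_twoSided hl.le hu c').sub (continuousOn_barrierGap c')).neg ?_ ?_ ?_ ?_ ht x
  · intro a b hb
    have := gFun_add_le_of_nonneg hl.le hlu (-(a + b)) hb
    rw [neg_add_rev, neg_add_cancel_comm] at this
    simp only [neg_add_rev]
    linarith
  · intro ψ t x a b ht hψ hmax
    have hmin : IsLocalMin (fun p : ℝ × ℝ => w p.1 p.2 - -ψ p) (t, x) := by
      filter_upwards [hmax] with p hp
      linarith
    have := hsup (fun p => -ψ p) t x ht hψ.neg.contDiffAt hmin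
    rw [hψ.neg.time, hψ.neg.space] at this
    linarith
  · intro t x ht
    rcases le_or_gt |x| c' with hx | hx
    · obtain ⟨ψ, a, b, h1, h2, h3, h4⟩ := lowerBarrier_touching_inner hl hlu hc0 ht hx
      exact ⟨ψ, a, b, h1, .of_forall h2, h3, h4⟩
    · obtain ⟨e, he, hex⟩ : ∃ e : ℝ, (e = 1 ∨ e = -1) ∧ c' < e * x := by
        rcases lt_abs.1 hx with h | h
        · exact ⟨1, .inl rfl, by linarith⟩
        · exact ⟨-1, .inr rfl, by linarith⟩
      obtain ⟨ψ, a, b, h1, h2, h3⟩ := lowerBarrier_touching_outer hl hlu hc0 ht he hex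
      exact ⟨ψ, a, b, h1, h2.mono fun p hp => hp.le, h2.self_of_nhds.symm, h3⟩
  · intro x ε hε
    have hlim : ∀ {e : ℝ}, e * x < c' →
        ∀ᶠ p in 𝓝[{p : ℝ × ℝ | 0 < p.1}] ((0 : ℝ), x),
          profile σl σu ((e * p.2 - c') / √p.1) < ε / 4 := fun h =>
      ((tendsto_profile_atBot hu).comp (tendsto_selfSimilar_atBot h)).eventually_lt_const
        (by positivity)
    suffices H : ∀ᶠ p in 𝓝[{p : ℝ × ℝ | 0 < p.1}] ((0 : ℝ), x),
        twoSided σl σu c' p.1 p.2 ≤ w p.1 p.2 + ε by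
      filter_upwards [H] with p hp
      linarith [hgap p.1 p.2]
    -- Since `c < c'`, both profiles vanish in the limit when `|x| ≤ c`; when `|x| > c` at least the
    -- far one does, while `w` is nearly at least `1`.
    rcases le_or_gt |x| c with hx | hx
    · have hev : ∀ᶠ y in 𝓝 x, 0 ≤ {x : ℝ | c < |x|}.indicator (1 : ℝ → ℝ) y :=
        .of_forall fun y => indicator_nonneg (fun _ _ => zero_le_one) y
      have hx' := abs_le.1 hx
      filter_upwards [hw.le_liminf x 0 hev (ε / 2) (by positivity), hlim (e := 1) (by linarith),
        hlim (e := -1) (by linarith)] with p h1 h2 h3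
      simp only [twoSided]
      linarith
    · have hev : ∀ᶠ y in 𝓝 x, 1 ≤ {x : ℝ | c < |x|}.indicator (1 : ℝ → ℝ) y := by
        filter_upwards [continuous_abs.continuousAt.eventually_const_lt hx] with y hy
        exact (indicator_of_mem (show y ∈ {x : ℝ | c < |x|} from hy) (1 : ℝ → ℝ)).ge
      have hone := fun y => profile_le_one hl.le hu y
      have hw1 := hw.le_liminf x 1 hev (ε / 2) (by positivity)
      rcases lt_abs.1 hx with h | h
      · filter_upwards [hw1, hlim (e := -1) (by linarith)] with p h1 h2
        simp only [twoSided]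
        linarith [hone ((1 * p.2 - c') / √p.1)]
      · filter_upwards [hw1, hlim (e := 1) (by linarith)] with p h1 h2
        simp only [twoSided]
        linarith [hone ((-1 * p.2 - c') / √p.1)]
  · intro T hT
    obtain ⟨C, k, hC⟩ := hw.growth T hT
    refine ⟨C + 2, k, fun t ht x => ?_⟩
    have h1 := (neg_le_abs _).trans (hC t ⟨ht.1.le, ht.2.le⟩ x)
    have h2 := twoSided_le_two hl.le hu c' t x
    have h3 : 0 ≤ |x| ^ k := by positivity
    linarith [hgap t x]

end barriers

/-! ### Removing the shift, and conclusion. -/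

theorem continuous_twoSided_interface {σl σu : ℝ} (hl : 0 ≤ σl) (hu : 0 < σu) (t x : ℝ) :
    Continuous fun c => twoSided σl σu c t x := by
  have := continuous_profile hl hu
  unfold twoSided
  fun_prop

/-- The lower bound for `w` at positive times, for a positive lower volatility. -/
theorem IsGHeatSolution.twoSided_sub_le_tail {σ₀ σl σu c : ℝ} {w : ℝ → ℝ → ℝ} (hl : 0 < σl)
    (hlu : σl ≤ σu) (hw : IsGHeatSolution σ₀ σu ({x : ℝ | c < |x|}.indicator 1) w)
    (hsup : IsGHeatSupersolution σl σu w) (hc : 0 < c) {t : ℝ} (ht : 0 < t) (x : ℝ) :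
    twoSided σl σu c t x - w t x ≤ 2 * (σu - σl) / σu * stdCDF (-(2 * c) / (σu * √t)) := by
  have hu : 0 < σu := hl.trans_le hlu
  have hΦ := continuous_stdCDF
  have h1 : Continuous fun c' => twoSided σl σu c' t x - w t x :=
    (continuous_twoSided_interface hl.le hu t x).sub continuous_const
  have h2 : Continuous fun c' =>
      2 / (σu + σl) * (σu - σl) * stdCDF ((0 * x - 2 * c' / σu) / √t) := by fun_prop
  have h := le_of_tendsto_of_tendsto ((h1.tendsto c).mono_left nhdsWithin_le_nhds)
    ((h2.tendsto c).mono_left nhdsWithin_le_nhds) (eventually_mem_nhdsWithin.mono fun c' hc' =>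
      hw.twoSided_sub_le hl hlu hsup hc (mem_Ioi.1 hc') ht x)
  have e : (0 * x - 2 * c / σu) / √t = -(2 * c) / (σu * √t) := by
    rw [← div_div]
    ring
  rw [e] at h
  -- The barrier gives the sharper constant `2 (σu - σl) / (σu + σl)`, weakened here.
  refine h.trans (mul_le_mul_of_nonneg_right ?_ (stdCDF_nonneg _))
  rw [div_mul_eq_mul_div]
  have := sub_nonneg.2 hlu
  gcongr
  linarith

theorem theorem3p2 (σl σu : ℝ) (hl : 0 ≤ σl) (hlu : σl ≤ σu) (hu : 0 < σu) (c : ℝ)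
    (w : ℝ → ℝ → ℝ)
    (hw : IsGHeatSolution σl σu ({x : ℝ | c < |x|}.indicator 1) w)
    (t x : ℝ) (ht : 0 ≤ t) (hc : σu * √t / 2 < c) :
    0 ≤ rightSol σl σu c t x + leftSol σl σu c t x - w t x ∧
      rightSol σl σu c t x + leftSol σl σu c t x - w t x ≤
        2 * (σu - σl) / σu * gaussTail σu c t := by
  have hc0 : 0 < c := lt_of_le_of_lt (by positivity) hc
  rcases ht.eq_or_lt with rfl | ht'
  · have h : (Ioi c).indicator 1 x + (Iio (-c)).indicator 1 x =
        {x : ℝ | c < |x|}.indicator (1 : ℝ → ℝ) x := by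
      have hdisj : Disjoint (Ioi c) (Iio (-c)) := Set.disjoint_left.2 fun y h1 h2 => by
        have h1' : c < y := h1
        have h2' : y < -c := h2
        linarith
      have hset : {x : ℝ | c < |x|} = Ioi c ∪ Iio (-c) := by
        ext y
        simp [lt_abs, lt_neg]
      rw [hset, indicator_union_of_disjoint hdisj]
    simp only [rightSol, leftSol, gaussTail, lt_irrefl, if_false, hw.initial, h]
    simp
  · have hsum : rightSol σl σu c t x + leftSol σl σu c t x = twoSided σl σu c t x := by
      simp [rightSol, leftSol, twoSided, ht']
    have htail : gaussTail σu c t = stdCDF (-(2 * c) / (σu * √t)) := if_pos ht'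
    rw [hsum, htail]
    constructor
    · rw [sub_nonneg]
      exact ge_of_tendsto (((continuous_twoSided_interface hl hu t x).tendsto c).mono_left
        (nhdsWithin_le_nhds (s := Iio c))) (eventually_mem_nhdsWithin.mono fun c' hc' =>
          hw.le_twoSided hl hlu hu (mem_Iio.1 hc') ht' x)
    · rcases hl.eq_or_lt with rfl | hl'
      -- Raising the lower volatility from `0` to `ε` lowers `G`, so `w` is also a supersolution for
      -- `ε`; then `ε ↓ 0`.
      · have hε : ∀ ε, 0 < ε → ε ≤ σu → twoSided ε σu c t x - w t x ≤
            2 * (σu - ε) / σu * stdCDF (-(2 * c) / (σu * √t)) := fun ε h0 h1 =>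
          hw.twoSided_sub_le_tail h0 h1 (fun ψ t x ht hψ hmin =>
            (gFun_anti_lower le_rfl h0.le h1 _).trans (hw.super ψ t x ht hψ hmin)) hc0 ht' x
        have h1 : Tendsto (fun ε => twoSided ε σu c t x - w t x) (𝓝[>] 0)
            (𝓝 (twoSided 0 σu c t x - w t x)) :=
          ((tendsto_profile_left hu _).add (tendsto_profile_left hu _)).sub_const _
        have h2 : Continuous fun ε => 2 * (σu - ε) / σu * stdCDF (-(2 * c) / (σu * √t)) := by
          fun_prop
        refine le_of_tendsto_of_tendsto h1 ((h2.tendsto 0).mono_left nhdsWithin_le_nhds) ?_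
        filter_upwards [Ioc_mem_nhdsGT hu] with ε h
        exact hε ε h.1 h.2
      · exact hw.twoSided_sub_le_tail hl' hlu hw.super hc0 ht' x
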